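/- Let $R$ be an associative ring with unit and let $M$ be a right $R$-module. An $\mathcal R$-module (resp. right $\mathcal R$-module) is a covariant additive functor from the category of left (resp. right) $R$-modules to the category of abelian groups; kernels, cokernels, products and direct sums of such functors are computed pointwise. The quasi-coherent $\mathcal R$-module associated with a right $R$-module $N$ is $\mathcal N(S)=N\otimes_R S$, and the quasi-coherent right $\mathcal R$-module associated with a left $R$-module $N$ is $\mathcal N(T)=T\otimes_R N$; for $N=R$ both are denoted by $\mathcal R$. The dual of an $\mathcal R$-module $\mathbb M$ is the right $\mathcal R$-module $\mathbb M^*$ given by $\mathbb M^*(N)=\operatorname{Hom}_{\mathcal R}(\mathbb M,\mathcal N)$ (natural transformations) for every right $R$-module $N$. An $\mathcal R$-module $\mathbb M$ preserves direct products if the natural map $\mathbb M(\prod_{i\in I}S_i)\to\prod_{i\in I}\mathbb M(S_i)$ is an isomorphism for every family $(S_i)_{i\in I}$ of left $R$-modules. $M$ is Mittag-Leffler if for every finitely presented right $R$-module $P$ and every homomorphism $f\colon P\to M$ there are a finitely presented right $R$-module $Q$ and a homomorphism $g\colon P\to Q$ such that $\ker(f\otimes_R S)=\ker(g\otimes_R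 S)$ for every left $R$-module $S$. $M$ is strict Mittag-Leffler if for every finitely generated submodule $i\colon N\hookrightarrow M$ there are a finitely presented right $R$-module $P$ and homomorphisms $f\colon M\to P$, $g\colon P\to M$ with $g\circ f\circ i=i$. Theorem. (1) $M$ is a Mittag-Leffler module if and only if the kernel of every morphism of $\mathcal R$-modules $\prod_{\mathbb N}\mathcal R\to\mathcal M$ preserves direct products. (2) $M$ is a strict Mittag-Leffler module if and only if the cokernel of every morphism of right $\mathcal R$-modules $\mathcal M^*\to\bigoplus_{\mathbb N}\mathcal R$ is isomorphic to an $\mathcal R$-submodule of a quasi-coherent right $\mathcal R$-module. -/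

import Mathlib

open CategoryTheory CategoryTheory.Limits MulOpposite
open scoped TensorProduct

universe u

namespace FunctorialModules

noncomputable section

/-! Throughout, `R` is an arbitrary (associative, unital) ring, left `R`-modules are objects of
`ModuleCat.{u} R` and right `R`-modules are objects of `ModuleCat.{u} Rᵐᵒᵖ`, the right action being
`m * r = op r • m`. -/

/-! ### The tensor product over a noncommutative ring -/

section BalancedTensor

variable (R : Type u) [Ring R]

/-- The subgroup of `M ⊗[ℤ] S` generated by the elements `(m * r) ⊗ s - m ⊗ (r * s)`. -/
def balancingSubgroup (M S : Type u) [AddCommGroup M] [Module Rᵐᵒᵖ M] [AddCommGroup S]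
    [Module R S] : AddSubgroup (M ⊗[ℤ] S) :=
  AddSubgroup.closure
    {x | ∃ (m : M) (r : R) (s : S), x = (op r • m) ⊗ₜ[ℤ] s - m ⊗ₜ[ℤ] (r • s)}

/-- The abelian group `M ⊗_R S`, for a right `R`-module `M` and a left `R`-module `S`. -/
abbrev BalancedTensor (M S : Type u) [AddCommGroup M] [Module Rᵐᵒᵖ M] [AddCommGroup S]
    [Module R S] : Type u :=
  (M ⊗[ℤ] S) ⧸ balancingSubgroup R M S

variable {M M' M'' S S' S'' : Type u}
  [AddCommGroup M] [Module Rᵐᵒᵖ M] [AddCommGroup M'] [Module Rᵐᵒᵖ M']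
  [AddCommGroup M''] [Module Rᵐᵒᵖ M'']
  [AddCommGroup S] [Module R S] [AddCommGroup S'] [Module R S'] [AddCommGroup S''] [Module R S'']

/-- The pure tensor `m ⊗ s` in `M ⊗_R S`. -/
def BalancedTensor.tmul (m : M) (s : S) : BalancedTensor R M S :=
  QuotientAddGroup.mk (m ⊗ₜ[ℤ] s)

variable {R}

/-- The homomorphism `f ⊗ g : M ⊗_R S → M' ⊗_R S'`, which sends `m ⊗ s` to `f m ⊗ g s`. -/
def BalancedTensor.map (f : M →ₗ[Rᵐᵒᵖ] M') (g : S →ₗ[R] S') :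
    BalancedTensor R M S →+ BalancedTensor R M' S' :=
  QuotientAddGroup.map _ _
    (TensorProduct.map f.toAddMonoidHom.toIntLinearMap
      g.toAddMonoidHom.toIntLinearMap).toAddMonoidHom
    (by
      refine (AddSubgroup.closure_le _).2 ?_
      rintro _ ⟨m, r, s, rfl⟩
      refine AddSubgroup.subset_closure ⟨f m, r, g s, ?_⟩
      simp)

@[simp]
theorem BalancedTensor.map_tmul (f : M →ₗ[Rᵐᵒᵖ] M') (g : S →ₗ[R] S') (m : M) (s : S) :
    BalancedTensor.map f g (BalancedTensor.tmul R m s) = BalancedTensor.tmul R (f m) (g s) :=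
  rfl

theorem BalancedTensor.hom_ext {A : Type*} [AddCommGroup A] {φ ψ : BalancedTensor R M S →+ A}
    (h : ∀ m s, φ (BalancedTensor.tmul R m s) = ψ (BalancedTensor.tmul R m s)) : φ = ψ := by
  refine QuotientAddGroup.addMonoidHom_ext _ (AddMonoidHom.ext fun x => ?_)
  induction x using TensorProduct.induction_on with
  | zero => simp
  | tmul m s => exact h m s
  | add x y hx hy => rw [map_add, map_add, hx, hy]

theorem BalancedTensor.add_tmul (m m' : M) (s : S) :
    BalancedTensor.tmul R (m + m') s = BalancedTensor.tmul R m s + BalancedTensor.tmul R m' s :=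
  congrArg QuotientAddGroup.mk (TensorProduct.add_tmul m m' s)

theorem BalancedTensor.tmul_add (m : M) (s s' : S) :
    BalancedTensor.tmul R m (s + s') = BalancedTensor.tmul R m s + BalancedTensor.tmul R m s' :=
  congrArg QuotientAddGroup.mk (TensorProduct.tmul_add m s s')

theorem BalancedTensor.map_id :
    BalancedTensor.map (LinearMap.id : M →ₗ[Rᵐᵒᵖ] M) (LinearMap.id : S →ₗ[R] S) =
      AddMonoidHom.id _ :=
  BalancedTensor.hom_ext fun _ _ => rfl

theorem BalancedTensor.map_comp (f' : M' →ₗ[Rᵐᵒᵖ] M'') (f : M →ₗ[Rᵐᵒᵖ] M')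
    (g' : S' →ₗ[R] S'') (g : S →ₗ[R] S') :
    BalancedTensor.map (f' ∘ₗ f) (g' ∘ₗ g) =
      (BalancedTensor.map f' g').comp (BalancedTensor.map f g) :=
  BalancedTensor.hom_ext fun _ _ => rfl

end BalancedTensor

/-! ### Functors of modules -/

variable (R : Type u) [Ring R]

/-- The category of functors from left `R`-modules to abelian groups. The modules are those of the
universe `u`; the abelian groups are taken one universe higher, so that the group of all morphisms
between two such functors is again a possible value of such a functor. The `𝓡`-modules are the
additive functors; kernels, cokernels, products and direct sums of these are computed pointwise. -/
abbrev FunctorOfModules : Type (u + 2) :=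
  ModuleCat.{u} R ⥤ AddCommGrpCat.{u + 1}

/-- The bifunctor `(M, S) ↦ M ⊗_R S`, for `M` a right and `S` a left `R`-module. -/
def tensorBifunctor : ModuleCat.{u} Rᵐᵒᵖ ⥤ ModuleCat.{u} R ⥤ AddCommGrpCat.{u + 1} where
  obj M :=
    { obj := fun S => AddCommGrpCat.of (ULift.{u + 1} (BalancedTensor R M S))
      map := fun g => AddCommGrpCat.ofHom
        ((AddEquiv.ulift.symm.toAddMonoidHom.comp (BalancedTensor.map LinearMap.id g.hom)).comp
          AddEquiv.ulift.toAddMonoidHom)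
      map_id := fun S => by
        ext ⟨x⟩
        exact (DFunLike.congr_fun BalancedTensor.map_id x)
      map_comp := fun g g' => by
        ext ⟨x⟩
        exact 
          (DFunLike.congr_fun (BalancedTensor.map_comp LinearMap.id LinearMap.id g'.hom g.hom) x) }
  map f :=
    { app := fun S => AddCommGrpCat.ofHom
        ((AddEquiv.ulift.symm.toAddMonoidHom.comp (BalancedTensor.map f.hom LinearMap.id)).comp
          AddEquiv.ulift.toAddMonoidHom)
      naturality := fun S S' g => by
        ext ⟨x⟩
        exact (
          (DFunLike.congr_fun (BalancedTensor.map_comp f.hom LinearMap.id LinearMap.id g.hom)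
            x).symm.trans
          (DFunLike.congr_fun (BalancedTensor.map_comp LinearMap.id f.hom g.hom LinearMap.id) x)) }
  map_id M := by
    ext S ⟨x⟩
    exact (DFunLike.congr_fun BalancedTensor.map_id x)
  map_comp f f' := by
    ext S ⟨x⟩
    exact 
      (DFunLike.congr_fun (BalancedTensor.map_comp f'.hom f.hom LinearMap.id LinearMap.id) x)

variable {R}

/-- The quasi-coherent `𝓡`-module `S ↦ M ⊗_R S` associated with a right `R`-module `M`. -/
abbrev quasiCoherent (M : ModuleCat.{u} Rᵐᵒᵖ) : FunctorOfModules R :=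
  (tensorBifunctor R).obj M

/-- The quasi-coherent right `𝓡`-module `T ↦ T ⊗_R N` associated with a left `R`-module `N`. -/
abbrev quasiCoherentRight (N : ModuleCat.{u} R) : FunctorOfModules Rᵐᵒᵖ :=
  (tensorBifunctor R).flip.obj N

/-- The dual `N ↦ Hom_𝓡(𝕄, 𝓝)` of an `𝓡`-module `𝕄`, a functor on right `R`-modules `N`; here
`𝓝` is the quasi-coherent module `S ↦ N ⊗_R S` and `Hom_𝓡` is the group of all natural
transformations. -/
def dual (𝕄 : FunctorOfModules R) : FunctorOfModules Rᵐᵒᵖ :=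
  tensorBifunctor R ⋙ preadditiveCoyoneda.obj (Opposite.op 𝕄)

theorem BalancedTensor.map_add_right (M S S' : Type u) [AddCommGroup M] [Module Rᵐᵒᵖ M]
    [AddCommGroup S] [Module R S] [AddCommGroup S'] [Module R S'] (g g' : S →ₗ[R] S') :
    BalancedTensor.map (LinearMap.id : M →ₗ[Rᵐᵒᵖ] M) (g + g') =
      BalancedTensor.map LinearMap.id g + BalancedTensor.map LinearMap.id g' :=
  BalancedTensor.hom_ext fun m s => BalancedTensor.tmul_add m (g s) (g' s)

theorem BalancedTensor.map_add_left (M M' S : Type u) [AddCommGroup M] [Module Rᵐᵒᵖ M]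
    [AddCommGroup M'] [Module Rᵐᵒᵖ M'] [AddCommGroup S] [Module R S] (f f' : M →ₗ[Rᵐᵒᵖ] M') :
    BalancedTensor.map (f + f') (LinearMap.id : S →ₗ[R] S) =
      BalancedTensor.map f LinearMap.id + BalancedTensor.map f' LinearMap.id :=
  BalancedTensor.hom_ext fun m s => BalancedTensor.add_tmul (f m) (f' m) s

instance quasiCoherent_additive (M : ModuleCat.{u} Rᵐᵒᵖ) : (quasiCoherent M).Additive where
  map_add {_ _ g g'} := by
    ext ⟨x⟩
    exact congrArg ULift.up
      (DFunLike.congr_fun (BalancedTensor.map_add_right M _ _ g.hom g'.hom) x)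

instance tensorBifunctor_additive : (tensorBifunctor R).Additive where
  map_add {_ _ f f'} := by
    ext S ⟨x⟩
    exact congrArg ULift.up
      (DFunLike.congr_fun (BalancedTensor.map_add_left _ _ S f.hom f'.hom) x)

instance quasiCoherentRight_additive (N : ModuleCat.{u} R) :
    (quasiCoherentRight N).Additive where
  map_add {_ _ f f'} :=
    congrArg (fun η => NatTrans.app η N) ((tensorBifunctor R).map_add (f := f) (g := f'))

instance dual_additive (𝕄 : FunctorOfModules R) : (dual 𝕄).Additive :=
  inferInstanceAs (tensorBifunctor R ⋙ preadditiveCoyoneda.obj (Opposite.op 𝕄)).Additive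

/-- `𝕄` preserves direct products: the natural map `𝕄(∏ᵢ Sᵢ) → ∏ᵢ 𝕄(Sᵢ)` is an isomorphism for
every family `(Sᵢ)` of modules indexed by a set. -/
def PreservesDirectProducts (𝕄 : FunctorOfModules R) : Prop :=
  ∀ I : Type u, PreservesLimitsOfShape (Discrete I) 𝕄

/-! ### Mittag-Leffler and strict Mittag-Leffler modules -/

/-- A right `R`-module `M` is a Mittag-Leffler module if for every finitely presented right
`R`-module `P` and every homomorphism `f : P → M` there are a finitely presented right `R`-module
`Q` and a homomorphism `g : P → Q` such that `f` and `g` dominate each other: for every left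
`R`-module `S` the maps `f ⊗ S : P ⊗_R S → M ⊗_R S` and `g ⊗ S : P ⊗_R S → Q ⊗_R S` have
the same kernel. -/
def IsMittagLeffler (M : ModuleCat.{u} Rᵐᵒᵖ) : Prop :=
  ∀ (P : ModuleCat.{u} Rᵐᵒᵖ), Module.FinitePresentation Rᵐᵒᵖ P → ∀ f : P →ₗ[Rᵐᵒᵖ] M,
    ∃ Q : ModuleCat.{u} Rᵐᵒᵖ, Module.FinitePresentation Rᵐᵒᵖ Q ∧ ∃ g : P →ₗ[Rᵐᵒᵖ] Q,
      ∀ S : ModuleCat.{u} R,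
        (BalancedTensor.map f (LinearMap.id : S →ₗ[R] S)).ker =
          (BalancedTensor.map g (LinearMap.id : S →ₗ[R] S)).ker

/-- A right `R`-module `M` is a strict Mittag-Leffler module if for every finitely generated
submodule `N` of `M` there are a finitely presented module `P` and homomorphisms `f : M → P` and
`g : P → M` such that `g ∘ f` is the identity on `N`. -/
def IsStrictMittagLeffler (M : ModuleCat.{u} Rᵐᵒᵖ) : Prop :=
  ∀ N : Submodule Rᵐᵒᵖ M, N.FG →
    ∃ P : ModuleCat.{u} Rᵐᵒᵖ, Module.FinitePresentation Rᵐᵒᵖ P ∧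
      ∃ (f : M →ₗ[Rᵐᵒᵖ] P) (g : P →ₗ[Rᵐᵒᵖ] M), g ∘ₗ f ∘ₗ N.subtype = N.subtype

end

end FunctorialModules

/-!
(1) `M` is Mittag-Leffler if and only if `M ⊗_R ∏ⱼ Tⱼ → ∏ⱼ (M ⊗_R Tⱼ)` is injective for every
family `T`. An element of the source is a finite sum `∑ mᵢ ⊗ sᵢ`, that is, the value at `s` of the
morphism `∏ 𝓡 → 𝓜` determined by `m`; the kernel of this morphism preserves direct products if and
only if each of its values vanishes as soon as its images in all `M ⊗_R Tⱼ` do.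

(2) A morphism `𝓜^* → ⨁ 𝓡` is a finitely supported family `m` in `M`, with image at `N` the orbit
`{φ m | φ : M → N}`, and a morphism `⨁ 𝓡 → 𝓦` is a family `w` in `W`, with kernel at `N` the set
`{n | ∑ nᵢ ⊗ wᵢ = 0}`. Hence the condition says that every orbit is cut out by some `w`. For a
family in a finite free module take for `W` the left module with one generator for each index and
with the coordinates of the family as relations; the property passes to quotients by finitely
generated submodules and to retracts. Conversely, if `w` cuts out the orbit of `m`, then
`∑ mᵢ ⊗ wᵢ = 0` already holds for a lift `q` of `m` to a finitely presented module `Q` over `M`, so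
some `φ : M → Q` sends `m` to `q`.
-/

namespace FunctorialModules

noncomputable section

section BalancedTensor

variable {R : Type u} [Ring R]
variable {M M' M'' S S' S'' : Type u}
  [AddCommGroup M] [Module Rᵐᵒᵖ M] [AddCommGroup M'] [Module Rᵐᵒᵖ M']
  [AddCommGroup M''] [Module Rᵐᵒᵖ M'']
  [AddCommGroup S] [Module R S] [AddCommGroup S'] [Module R S'] [AddCommGroup S''] [Module R S'']

namespace BalancedTensor

/-- The homomorphism out of `M ⊗_R S` induced by a balanced biadditive map. -/
def lift {A : Type*} [AddCommGroup A] (φ : M →+ S →+ A)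
    (balanced : ∀ (m : M) (r : R) (s : S), φ (op r • m) s = φ m (r • s)) :
    BalancedTensor R M S →+ A :=
  QuotientAddGroup.lift _ (TensorProduct.liftAddHom (R := ℤ) φ fun n m s => by simp) (by
    refine (AddSubgroup.closure_le _).2 ?_
    rintro _ ⟨m, r, s, rfl⟩
    simp [balanced])

@[simp]
theorem lift_tmul {A : Type*} [AddCommGroup A] (φ : M →+ S →+ A)
    (balanced : ∀ (m : M) (r : R) (s : S), φ (op r • m) s = φ m (r • s)) (m : M) (s : S) :
    lift φ balanced (tmul R m s) = φ m s :=
  rfl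

theorem smul_tmul (r : R) (m : M) (s : S) : tmul R (op r • m) s = tmul R m (r • s) :=
  (QuotientAddGroup.eq_iff_sub_mem).2 (AddSubgroup.subset_closure ⟨m, r, s, rfl⟩)

variable (R) in
/-- The biadditive map `(m, s) ↦ m ⊗ s`. -/
def mk : M →+ S →+ BalancedTensor R M S :=
  AddMonoidHom.mk' (fun m => AddMonoidHom.mk' (tmul R m) (tmul_add m))
    fun m m' => AddMonoidHom.ext (add_tmul m m')

@[simp]
theorem mk_apply (m : M) (s : S) : mk R m s = tmul R m s :=
  rfl

theorem map_comp_apply (f' : M' →ₗ[Rᵐᵒᵖ] M'') (f : M →ₗ[Rᵐᵒᵖ] M') (g' : S' →ₗ[R] S'')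
    (g : S →ₗ[R] S') (x : BalancedTensor R M S) :
    map (f' ∘ₗ f) (g' ∘ₗ g) x = map f' g' (map f g x) :=
  DFunLike.congr_fun (map_comp f' f g' g) x

theorem map_id_comp_apply (f' : M' →ₗ[Rᵐᵒᵖ] M'') (f : M →ₗ[Rᵐᵒᵖ] M')
    (x : BalancedTensor R M S) :
    map (f' ∘ₗ f) (.id : S →ₗ[R] S) x = map f' .id (map f .id x) :=
  map_comp_apply f' f .id .id x

theorem map_left_map_right (f : M →ₗ[Rᵐᵒᵖ] M') (g : S →ₗ[R] S') (x : BalancedTensor R M S) :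
    map f .id (map .id g x) = map f g x :=
  (map_comp_apply f .id .id g x).symm

theorem map_right_map_left (f : M →ₗ[Rᵐᵒᵖ] M') (g : S →ₗ[R] S') (x : BalancedTensor R M S) :
    map .id g (map f .id x) = map f g x :=
  (map_comp_apply .id f g .id x).symm

section Exactness

theorem balancingSubgroup_le_map {p : M →ₗ[Rᵐᵒᵖ] M'} {q : S →ₗ[R] S'}
    (hp : Function.Surjective p) (hq : Function.Surjective q) :
    balancingSubgroup R M' S' ≤ (balancingSubgroup R M S).map
      (TensorProduct.map p.toAddMonoidHom.toIntLinearMap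
        q.toAddMonoidHom.toIntLinearMap).toAddMonoidHom := by
  refine (AddSubgroup.closure_le _).2 ?_
  rintro _ ⟨m', r, s', rfl⟩
  obtain ⟨m, rfl⟩ := hp m'
  obtain ⟨s, rfl⟩ := hq s'
  exact ⟨_, AddSubgroup.subset_closure ⟨m, r, s, rfl⟩, by simp⟩

/-- Exactness descends from `⊗[ℤ]` because the balancing relations lift along surjections. -/
theorem map_exact {f : M →ₗ[Rᵐᵒᵖ] M'} {g : S →ₗ[R] S'} {p : M' →ₗ[Rᵐᵒᵖ] M''} {q : S' →ₗ[R] S''}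
    (h : Function.Exact
      (TensorProduct.map f.toAddMonoidHom.toIntLinearMap g.toAddMonoidHom.toIntLinearMap)
      (TensorProduct.map p.toAddMonoidHom.toIntLinearMap q.toAddMonoidHom.toIntLinearMap))
    (hp : Function.Surjective p) (hq : Function.Surjective q) :
    Function.Exact (map f g) (map p q) := by
  intro x
  obtain ⟨b, rfl⟩ := QuotientAddGroup.mk_surjective x
  constructor
  · intro hb
    obtain ⟨b', hb', hpq⟩ := balancingSubgroup_le_map hp hq ((QuotientAddGroup.eq_zero_iff _).1 hb)
    obtain ⟨a, ha⟩ := (h (b - b')).1 (by rw [map_sub, sub_eq_zero]; exact hpq.symm)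
    refine ⟨QuotientAddGroup.mk a, (congrArg QuotientAddGroup.mk ha).trans ?_⟩
    exact (QuotientAddGroup.eq_iff_sub_mem).2 (by simpa using hb')
  · rintro ⟨a, ha⟩
    obtain ⟨a, rfl⟩ := QuotientAddGroup.mk_surjective a
    rw [← ha]
    exact congrArg QuotientAddGroup.mk (h.apply_apply_eq_zero a)

theorem map_left_exact {f : M →ₗ[Rᵐᵒᵖ] M'} {p : M' →ₗ[Rᵐᵒᵖ] M''} (h : Function.Exact f p)
    (hp : Function.Surjective p) :
    Function.Exact (map f (.id : S →ₗ[R] S)) (map p (.id : S →ₗ[R] S)) :=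
  map_exact (rTensor_exact (R := ℤ) S (f := f.toAddMonoidHom.toIntLinearMap)
    (g := p.toAddMonoidHom.toIntLinearMap) h hp) hp Function.surjective_id

theorem map_right_exact {g : S →ₗ[R] S'} {q : S' →ₗ[R] S''} (h : Function.Exact g q)
    (hq : Function.Surjective q) :
    Function.Exact (map (.id : M →ₗ[Rᵐᵒᵖ] M) g) (map (.id : M →ₗ[Rᵐᵒᵖ] M) q) :=
  map_exact (lTensor_exact (R := ℤ) M (f := g.toAddMonoidHom.toIntLinearMap)
    (g := q.toAddMonoidHom.toIntLinearMap) h hq) Function.surjective_id hq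

theorem map_left_surjective {p : M →ₗ[Rᵐᵒᵖ] M'} (hp : Function.Surjective p) :
    Function.Surjective (map p (.id : S →ₗ[R] S)) :=
  QuotientAddGroup.map_surjective_of_surjective _ _ _
    ((QuotientAddGroup.mk_surjective).comp
      (TensorProduct.map_surjective (R := ℤ) (g := p.toAddMonoidHom.toIntLinearMap)
        (g' := LinearMap.id) hp Function.surjective_id)) _

end Exactness

section SumTmul

variable {ι : Type*}

variable (R) in
/-- The homomorphism `n ↦ ∑ᵢ nᵢ ⊗ wᵢ` determined by a family `w` of elements of a left module. -/
def sumTmul (w : ι → S) : (ι →₀ M) →+ BalancedTensor R M S :=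
  Finsupp.liftAddHom fun i => (mk R).flip (w i)

@[simp]
theorem sumTmul_single (w : ι → S) (i : ι) (m : M) :
    sumTmul R w (Finsupp.single i m) = tmul R m (w i) := by
  simp [sumTmul]

theorem map_sumTmul (f : M →ₗ[Rᵐᵒᵖ] M') (g : S →ₗ[R] S') (w : ι → S) (n : ι →₀ M) :
    map f g (sumTmul R w n) = sumTmul R (g ∘ w) (Finsupp.mapRange.linearMap f n) := by
  induction n using Finsupp.induction_linear with
  | zero => simp
  | add n n' hn hn' => simp only [map_add, hn, hn']
  | single i m => simp

theorem sumTmul_mapDomain {κ : Type*} (g : ι → κ) (w : κ → S) (n : ι →₀ M) :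
    sumTmul R w (n.mapDomain g) = sumTmul R (w ∘ g) n := by
  induction n using Finsupp.induction_linear with
  | zero => simp
  | add n n' hn hn' => simp only [Finsupp.mapDomain_add, map_add, hn, hn']
  | single i m => simp

theorem exists_sumTmul_eq [Infinite ι] (x : BalancedTensor R M S) :
    ∃ (w : ι → S) (n : ι →₀ M), sumTmul R w n = x := by
  obtain ⟨y, rfl⟩ := QuotientAddGroup.mk_surjective x
  obtain ⟨t, rfl⟩ := TensorProduct.exists_finset y
  let e : t ↪ ι := t.equivFin.toEmbedding.trans (Fin.valEmbedding.trans (Infinite.natEmbedding ι))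
  refine ⟨Function.extend e (fun a => a.1.2) 0, ∑ a : t, Finsupp.single (e a) a.1.1, ?_⟩
  have hw (a : t) : Function.extend e (fun a => a.1.2) 0 (e a) = a.1.2 :=
    e.injective.extend_apply _ _ a
  simp only [map_sum, sumTmul_single, hw]
  rw [Finset.sum_coe_sort t fun a => tmul R a.1 a.2]
  exact (map_sum (QuotientAddGroup.mk' (balancingSubgroup R M S)) (fun a => a.1 ⊗ₜ[ℤ] a.2) t).symm

theorem exists_fg_map_mkQ_eq_zero {p : M →ₗ[Rᵐᵒᵖ] M'} (hp : Function.Surjective p)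
    {x : BalancedTensor R M S} (hx : map p (.id : S →ₗ[R] S) x = 0) :
    ∃ N : Submodule Rᵐᵒᵖ M, N.FG ∧ N ≤ LinearMap.ker p ∧ map N.mkQ (.id : S →ₗ[R] S) x = 0 := by
  obtain ⟨k, rfl⟩ := (map_left_exact p.exact_subtype_ker_map hp x).1 hx
  obtain ⟨s, n, rfl⟩ := exists_sumTmul_eq (ι := ℕ) k
  refine ⟨Submodule.span _ (Set.range fun i => (n i : M)), ?_, ?_, ?_⟩
  · exact Submodule.fg_span ((n.finite_range).image _ |>.subset (Set.range_comp _ _).le)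
  · rw [Submodule.span_le]
    rintro _ ⟨i, rfl⟩
    exact (n i).2
  · rw [map_sumTmul, map_sumTmul]
    convert map_zero (sumTmul R _)
    ext i
    simpa using Submodule.subset_span (Set.mem_range_self i)

end SumTmul

section Scalars

variable (R) in
/-- The biadditive map `(m, r) ↦ m * r` of a right module. -/
def rightAction : M →+ R →+ M :=
  ((smulAddHom Rᵐᵒᵖ M).comp (opAddEquiv : R ≃+ Rᵐᵒᵖ).toAddMonoidHom).flip

@[simp]
theorem rightAction_apply (m : M) (r : R) : rightAction R m r = op r • m :=
  rfl

/-- The isomorphism `R ⊗_R S ≃ S`, `r ⊗ s ↦ r * s`. -/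
def lid : BalancedTensor R R S ≃+ S :=
  (lift (smulAddHom R S) fun a r s => mul_smul a r s).toAddEquiv (mk R 1)
    (hom_ext fun r s => (smul_tmul r 1 s).symm.trans (congrArg (mk R · s) (one_mul r)))
    (AddMonoidHom.ext (one_smul R))

@[simp]
theorem lid_symm_apply (s : S) : lid.symm s = tmul R 1 s :=
  rfl

theorem lid_map (g : S →ₗ[R] S') (x : BalancedTensor R R S) :
    lid (map .id g x) = g (lid x) := by
  obtain ⟨s, rfl⟩ := lid.symm.surjective x
  rw [AddEquiv.apply_symm_apply, lid_symm_apply, map_tmul, ← LinearMap.id_apply (R := Rᵐᵒᵖ) (1 : R)]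
  exact lid.apply_symm_apply (g s)

/-- The isomorphism `M ⊗_R R ≃ M`, `m ⊗ r ↦ m * r`. -/
def rid : BalancedTensor R M R ≃+ M :=
  (lift (rightAction R) fun m r r' => by simp [mul_smul]).toAddEquiv ((mk R).flip 1)
    (hom_ext fun m r => (smul_tmul r m 1).trans (congrArg (mk R m) (mul_one r)))
    (AddMonoidHom.ext (one_smul Rᵐᵒᵖ))

/-- The homomorphism `r ↦ m * r` of right modules. -/
def toSpanSingletonRight (m : M) : R →ₗ[Rᵐᵒᵖ] M where
  __ := rightAction R m
  map_smul' a r := by simp [mul_smul]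

@[simp]
theorem toSpanSingletonRight_one (m : M) : toSpanSingletonRight m (1 : R) = m :=
  one_smul Rᵐᵒᵖ m

theorem map_left_eq_tmul_lid (f : R →ₗ[Rᵐᵒᵖ] M) (x : BalancedTensor R R S) :
    map f .id x = tmul R (f 1) (lid x) := by
  obtain ⟨s, rfl⟩ := lid.symm.surjective x
  rw [AddEquiv.apply_symm_apply]
  rfl

theorem map_right_eq_tmul_rid (g : R →ₗ[R] S) (x : BalancedTensor R M R) :
    map .id g x = tmul R (rid x) (g 1) := by
  obtain ⟨m, rfl⟩ := rid.symm.surjective x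
  rw [AddEquiv.apply_symm_apply]
  rfl

section Pi

variable {κ : Type}

/-- The coordinate map `R^κ ⊗_R S → S`, `a ⊗ s ↦ aₖ * s`. -/
def piCoord (k : κ) : BalancedTensor R (κ → Rᵐᵒᵖ) S →+ S :=
  lift ((smulAddHom R S).comp
    ((opAddEquiv : R ≃+ Rᵐᵒᵖ).symm.toAddMonoidHom.comp (Pi.evalAddMonoidHom _ k)))
    fun a r s => mul_smul (unop (a k)) r s

theorem piCoord_map (k : κ) (g : S →ₗ[R] S') (x : BalancedTensor R (κ → Rᵐᵒᵖ) S) :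
    piCoord k (map .id g x) = g (piCoord k x) :=
  DFunLike.congr_fun (f := (piCoord k).comp (map .id g)) (g := g.toAddMonoidHom.comp (piCoord k))
    (hom_ext fun a s => (map_smul g (unop (a k)) s).symm) x

/-- The isomorphism `R^κ ⊗_R S ≃ S^κ` for finite `κ`. -/
def piScalarLeft [Fintype κ] [DecidableEq κ] : BalancedTensor R (κ → Rᵐᵒᵖ) S ≃+ (κ → S) :=
  (AddMonoidHom.pi piCoord).toAddEquiv
    (∑ k, ((mk R) (Pi.single k 1 : κ → Rᵐᵒᵖ)).comp (Pi.evalAddMonoidHom _ k))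
    (hom_ext fun a s => by
      have tmul_single (k : κ) : tmul R (Pi.single k 1 : κ → Rᵐᵒᵖ) (unop (a k) • s) =
          (mk R).flip s (Pi.single k (a k)) := by
        rw [← smul_tmul, ← Pi.single_smul]
        simp
      change _ = (mk R).flip s a
      rw [AddMonoidHom.comp_apply, AddMonoidHom.finsetSum_apply]
      refine (Finset.sum_congr rfl fun k _ => tmul_single k).trans ?_
      rw [← map_sum, Finset.univ_sum_single])
    (AddMonoidHom.ext fun s => funext fun l => by
      have piCoord_tmul_single (k : κ) :
          piCoord l (tmul R (Pi.single k 1) (s k)) = if l = k then s k else 0 := by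
        rcases eq_or_ne l k with rfl | h
        · simp [piCoord]
        · simp [piCoord, h]
      simp [piCoord_tmul_single])

theorem piScalarLeft_apply [Fintype κ] [DecidableEq κ] (x : BalancedTensor R (κ → Rᵐᵒᵖ) S) (k : κ) :
    piScalarLeft x k = piCoord k x :=
  rfl

end Pi

/-- The isomorphism `M ⊗_R R^(ι) ≃ M^(ι)`. -/
def finsuppScalarRight {ι : Type} : BalancedTensor R M (ι →₀ R) ≃+ (ι →₀ M) :=
  (lift (AddMonoidHom.mk' (fun m => Finsupp.mapRange.addMonoidHom (rightAction R m))
      fun m m' => by ext; simp) fun m r g => by ext; simp [mul_smul]).toAddEquiv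
    (sumTmul R fun i => Finsupp.single i 1)
    (hom_ext fun m g => DFunLike.congr_fun
      (f := ((sumTmul R fun i => Finsupp.single i (1 : R)).comp
        (Finsupp.mapRange.addMonoidHom (rightAction R m))))
      (g := mk R m) (Finsupp.addHom_ext fun i r => by simp [smul_tmul]) g)
    (Finsupp.addHom_ext fun i m => by simp)

theorem finsuppScalarRight_symm_apply {ι : Type} (n : ι →₀ M) :
    finsuppScalarRight.symm n = sumTmul R (fun i => Finsupp.single i 1) n :=
  rfl

theorem finsuppScalarRight_tmul {ι : Type} (m : M) (g : ι →₀ R) (i : ι) :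
    finsuppScalarRight (tmul R m g) i = op (g i) • m :=
  rfl

theorem sumTmul_mkQ_single_eq_zero_iff {ι κ : Type} (c : κ → ι →₀ R) (n : ι →₀ M) :
    sumTmul R (fun i => (Submodule.span R (Set.range c)).mkQ (Finsupp.single i 1)) n = 0 ↔
      ∃ z : κ →₀ M, finsuppScalarRight (sumTmul R c z) = n := by
  set U := Submodule.span R (Set.range c)
  have map_mkQ : map .id U.mkQ (finsuppScalarRight.symm n) =
      sumTmul R (fun i => U.mkQ (Finsupp.single i 1)) n := by
    rw [finsuppScalarRight_symm_apply, map_sumTmul]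
    simp [Function.comp_def]
  have map_linearCombination (z : κ →₀ M) :
      map .id (Finsupp.linearCombination R c) (finsuppScalarRight.symm z) = sumTmul R c z := by
    rw [finsuppScalarRight_symm_apply, map_sumTmul]
    simp [Function.comp_def]
  have exact : Function.Exact (Finsupp.linearCombination R c) U.mkQ := by
    rw [LinearMap.exact_iff, Submodule.ker_mkQ, Finsupp.range_linearCombination]
  rw [← map_mkQ, map_right_exact exact U.mkQ_surjective]
  refine (finsuppScalarRight.symm.surjective.exists).trans (exists_congr fun z => ?_)
  rw [map_linearCombination, AddEquiv.eq_symm_apply]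

end Scalars

section Products

variable {I : Type u} (T : I → Type u) [∀ j, AddCommGroup (T j)] [∀ j, Module R (T j)]

variable (R M) in
/-- The canonical map `M ⊗_R ∏ⱼ Tⱼ → ∏ⱼ (M ⊗_R Tⱼ)`. -/
def piRightHom : BalancedTensor R M (∀ j, T j) →+ ∀ j, BalancedTensor R M (T j) :=
  AddMonoidHom.pi fun j => map .id (LinearMap.proj j)

theorem piRightHom_apply (x : BalancedTensor R M (∀ j, T j)) (j : I) :
    piRightHom R M T x j = map .id (LinearMap.proj j) x :=
  rfl

theorem piRightHom_map (f : M →ₗ[Rᵐᵒᵖ] M') (x : BalancedTensor R M (∀ j, T j)) (j : I) :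
    piRightHom R M' T (map f .id x) j = map f .id (piRightHom R M T x j) := by
  rw [piRightHom_apply, piRightHom_apply, map_left_map_right, map_right_map_left]

theorem piRightHom_bijective_of_free (κ : Type) [Finite κ] :
    Function.Bijective (piRightHom R (κ → Rᵐᵒᵖ) T) := by
  classical
  cases nonempty_fintype κ
  constructor
  · refine fun x y h => piScalarLeft.injective ?_
    ext k j
    simpa only [piRightHom_apply, piScalarLeft_apply, piCoord_map, LinearMap.proj_apply] using
      congrArg (piCoord k) (congrFun h j)
  · refine fun z => ⟨piScalarLeft.symm fun k j => piScalarLeft (z j) k, funext fun j => ?_⟩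
    refine piScalarLeft.injective (funext fun k => ?_)
    rw [piRightHom_apply, piScalarLeft_apply, piCoord_map, ← piScalarLeft_apply,
      AddEquiv.apply_symm_apply, LinearMap.proj_apply]

theorem piRightHom_surjective_of_finite [Module.Finite Rᵐᵒᵖ M] :
    Function.Surjective (piRightHom R M T) := by
  intro z
  obtain ⟨n, p, hp⟩ := Module.Finite.exists_fin' Rᵐᵒᵖ M
  choose z' hz' using fun j => map_left_surjective (S := T j) hp (z j)
  obtain ⟨x, hx⟩ := (piRightHom_bijective_of_free (R := R) T (Fin n)).2 z'
  exact ⟨map p .id x, funext fun j => by rw [piRightHom_map, hx, hz']⟩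

theorem piRightHom_injective_of_finitePresentation [Module.FinitePresentation Rᵐᵒᵖ M] :
    Function.Injective (piRightHom R M T) := by
  obtain ⟨n, k, p, a, hp, hap⟩ := Module.FinitePresentation.exists_fin' Rᵐᵒᵖ M
  refine (injective_iff_map_eq_zero _).2 fun x hx => ?_
  obtain ⟨y, rfl⟩ := map_left_surjective hp x
  have relations (j : I) : ∃ z, map a .id z = piRightHom R (Fin n → Rᵐᵒᵖ) T y j := by
    refine (map_left_exact hap hp _).1 ?_
    rw [← piRightHom_map, hx, Pi.zero_apply]
  choose z hz using relations
  obtain ⟨v, hv⟩ := (piRightHom_bijective_of_free (R := R) T (Fin k)).2 z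
  have : map a .id v = y := (piRightHom_bijective_of_free T (Fin n)).1 <| funext fun j => by
    rw [piRightHom_map, hv, hz]
  rw [← this, (map_left_exact hap hp).apply_apply_eq_zero]

end Products

end BalancedTensor

end BalancedTensor

section FreeCover

variable {A P M : Type u} [Ring A] [AddCommGroup P] [Module A P] [AddCommGroup M] [Module A M]

/-- The surjection `P × A^(M) → M` extending a homomorphism `f : P → M`. -/
def freeCover (f : P →ₗ[A] M) : P × (M →₀ A) →ₗ[A] M :=
  f.coprod (Finsupp.linearCombination A id)

theorem freeCover_comp_inl (f : P →ₗ[A] M) : freeCover f ∘ₗ LinearMap.inl A P (M →₀ A) = f :=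
  LinearMap.coprod_inl _ _

theorem freeCover_surjective (f : P →ₗ[A] M) : Function.Surjective (freeCover f) :=
  fun m => ⟨(0, Finsupp.single m 1), by simp [freeCover]⟩

/-- The relations in `N` involve finitely many basis elements of `A^(M)`; these together with `P`
generate `Q`. -/
theorem exists_finitePresentation_factorization [Module.FinitePresentation A P] (f : P →ₗ[A] M)
    {N : Submodule A (P × (M →₀ A))} (hN : N.FG) (hle : N ≤ LinearMap.ker (freeCover f)) :
    ∃ Q : ModuleCat.{u} A, Module.FinitePresentation A Q ∧
      ∃ (α : ((P × (M →₀ A)) ⧸ N) →ₗ[A] Q) (h : Q →ₗ[A] M),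
        h ∘ₗ α ∘ₗ N.mkQ ∘ₗ LinearMap.inl A P (M →₀ A) = f := by
  classical
  obtain ⟨s, hs⟩ := hN
  let X : Finset M := s.biUnion fun k => k.2.support
  let restrict : P × (M →₀ A) →ₗ[A] P × (X →₀ A) :=
    LinearMap.prodMap .id (Finsupp.lcomapDomain Subtype.val Subtype.val_injective)
  let extend : P × (X →₀ A) →ₗ[A] P × (M →₀ A) :=
    LinearMap.prodMap .id (Finsupp.lmapDomain A A Subtype.val)
  have extend_restrict : Set.EqOn (extend ∘ₗ restrict) (LinearMap.id : _ →ₗ[A] _) N := by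
    rw [← hs]
    refine LinearMap.eqOn_span fun k hk => Prod.ext rfl ?_
    refine Finsupp.mapDomain_comapDomain _ Subtype.val_injective _ fun m hm => ?_
    rw [Subtype.range_coe_subtype]
    exact Finset.mem_biUnion.2 ⟨k, hk, hm⟩
  have map_le : N.map restrict ≤ LinearMap.ker (freeCover f ∘ₗ extend) := by
    rintro _ ⟨k, hk, rfl⟩
    exact (congrArg (freeCover f) (extend_restrict hk)).trans (hle hk)
  refine ⟨ModuleCat.of A ((P × (X →₀ A)) ⧸ N.map restrict), ?_,
    N.mapQ (N.map restrict) restrict (N.le_comap_map restrict),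
    (N.map restrict).liftQ (freeCover f ∘ₗ extend) map_le, ?_⟩
  · refine Module.finitePresentation_of_surjective _ (N.map restrict).mkQ_surjective ?_
    rw [Submodule.ker_mkQ]
    exact Submodule.FG.map restrict ⟨s, hs⟩
  · ext x
    simp [restrict, extend, freeCover]

end FreeCover

section Factorization

variable {R : Type u} [Ring R] {P M S : Type u} [AddCommGroup P] [Module Rᵐᵒᵖ P]
  [AddCommGroup M] [Module Rᵐᵒᵖ M] [AddCommGroup S] [Module R S]

theorem exists_fg_map_mkQ_inl_eq_zero (f : P →ₗ[Rᵐᵒᵖ] M) {x : BalancedTensor R P S}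
    (hx : BalancedTensor.map f (.id : S →ₗ[R] S) x = 0) :
    ∃ N : Submodule Rᵐᵒᵖ (P × (M →₀ Rᵐᵒᵖ)), N.FG ∧ N ≤ LinearMap.ker (freeCover f) ∧
      BalancedTensor.map (N.mkQ ∘ₗ LinearMap.inl _ _ _) (.id : S →ₗ[R] S) x = 0 := by
  simp only [BalancedTensor.map_id_comp_apply]
  refine BalancedTensor.exists_fg_map_mkQ_eq_zero (freeCover_surjective f) ?_
  rw [← BalancedTensor.map_id_comp_apply, freeCover_comp_inl, hx]

theorem exists_finitePresentation_map_eq_zero [Module.FinitePresentation Rᵐᵒᵖ P]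
    (f : P →ₗ[Rᵐᵒᵖ] M) {x : BalancedTensor R P S}
    (hx : BalancedTensor.map f (.id : S →ₗ[R] S) x = 0) :
    ∃ Q : ModuleCat.{u} Rᵐᵒᵖ, Module.FinitePresentation Rᵐᵒᵖ Q ∧
      ∃ (g : P →ₗ[Rᵐᵒᵖ] Q) (h : Q →ₗ[Rᵐᵒᵖ] M), h ∘ₗ g = f ∧
        BalancedTensor.map g (.id : S →ₗ[R] S) x = 0 := by
  obtain ⟨N, hN, hle, hNx⟩ := exists_fg_map_mkQ_inl_eq_zero f hx
  obtain ⟨Q, hQ, α, h, hf⟩ := exists_finitePresentation_factorization f hN hle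
  refine ⟨Q, hQ, α ∘ₗ N.mkQ ∘ₗ LinearMap.inl _ _ _, h, hf, ?_⟩
  rw [BalancedTensor.map_id_comp_apply, hNx, map_zero]

end Factorization

section FinitelySupportedFamilies

variable {A M ι : Type*} [Ring A] [AddCommGroup M] [Module A M]

theorem exists_mapRange_eq (m : ι →₀ M) :
    ∃ (n : ℕ) (f : (Fin n → A) →ₗ[A] M) (b : ι →₀ (Fin n → A)),
      Finsupp.mapRange.linearMap f b = m := by
  let e := m.support.equivFin.symm
  refine ⟨_, Fintype.linearCombination A fun k => m (e k),
    ∑ k, Finsupp.single (e k : ι) (Pi.single k 1), ?_⟩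
  simp only [map_sum, Finsupp.mapRange.linearMap_apply, Finsupp.mapRange_single,
    Fintype.linearCombination_apply_single, one_smul]
  rw [e.sum_comp fun i => Finsupp.single (i : ι) (m i),
    Finset.sum_coe_sort m.support fun i => Finsupp.single i (m i)]
  exact m.sum_single

theorem exists_span_range_eq [Infinite ι] {L : Submodule A M} (hL : L.FG) :
    ∃ m : ι →₀ M, Submodule.span A (Set.range m) = L := by
  obtain ⟨k, a, rfl⟩ := Submodule.fg_iff_exists_fin_generating_family.1 hL
  let e : Fin k ↪ ι := Fin.valEmbedding.trans (Infinite.natEmbedding ι)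
  have apply_e (l : Fin k) : Finsupp.embDomain e (Finsupp.equivFunOnFinite.symm a) (e l) = a l :=
    Finsupp.embDomain_apply_self _ _ l
  refine ⟨Finsupp.embDomain e (Finsupp.equivFunOnFinite.symm a), le_antisymm ?_ ?_⟩
  · rw [Submodule.span_le]
    rintro _ ⟨i, rfl⟩
    by_cases hi : i ∈ Set.range e
    · obtain ⟨l, rfl⟩ := hi
      exact apply_e l ▸ Submodule.subset_span (Set.mem_range_self l)
    · rw [Finsupp.embDomain_of_notMem_range _ _ _ hi]
      exact zero_mem _
  · refine Submodule.span_mono ?_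
    rintro _ ⟨l, rfl⟩
    exact ⟨e l, apply_e l⟩

theorem mapRange_comp_apply {M' M'' : Type*} [AddCommGroup M'] [Module A M'] [AddCommGroup M'']
    [Module A M''] (g : M' →ₗ[A] M'') (f : M →ₗ[A] M') (m : ι →₀ M) :
    Finsupp.mapRange.linearMap (g ∘ₗ f) m =
      Finsupp.mapRange.linearMap g (Finsupp.mapRange.linearMap f m) :=
  DFunLike.congr_fun (Finsupp.mapRange.linearMap_comp g f) m

end FinitelySupportedFamilies

section MittagLeffler

variable {R : Type u} [Ring R] {M : ModuleCat.{u} Rᵐᵒᵖ}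

theorem IsMittagLeffler.piRightHom_injective (hM : IsMittagLeffler M) {I : Type u}
    (T : I → ModuleCat.{u} R) :
    Function.Injective (BalancedTensor.piRightHom R M fun j => T j) := by
  refine (injective_iff_map_eq_zero _).2 fun x hx => ?_
  obtain ⟨s, m, rfl⟩ := BalancedTensor.exists_sumTmul_eq (ι := ℕ) x
  obtain ⟨n, f, b, rfl⟩ := exists_mapRange_eq (A := Rᵐᵒᵖ) m
  obtain ⟨Q, hQ, g, hker⟩ := hM (ModuleCat.of Rᵐᵒᵖ (Fin n → Rᵐᵒᵖ)) inferInstance f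
  have map_f : BalancedTensor.map f .id (BalancedTensor.sumTmul R s b) =
      BalancedTensor.sumTmul R s (Finsupp.mapRange.linearMap f b) :=
    BalancedTensor.map_sumTmul f .id s b
  rw [← map_f] at hx ⊢
  have map_g : BalancedTensor.map g .id (BalancedTensor.sumTmul R s b) = 0 := by
    refine (injective_iff_map_eq_zero _).1
      (BalancedTensor.piRightHom_injective_of_finitePresentation fun j => T j) _ ?_
    funext j
    rw [BalancedTensor.piRightHom_map]
    refine (SetLike.ext_iff.1 (hker (T j)) _).1 ?_
    rw [AddMonoidHom.mem_ker, ← BalancedTensor.piRightHom_map (fun j => T j), hx]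
    rfl
  exact (SetLike.ext_iff.1 (hker (ModuleCat.of R (∀ j, T j))) _).2 map_g

/-- If no factorization of `f : P → M` through a finitely presented module dominates `f`, then the
tensors witnessing this for all the finitely generated submodules of the kernel of the free cover
assemble to one tensor, on which the first comparison map fails to be injective. -/
theorem isMittagLeffler_of_piRightHom_injective
    (hM : ∀ (I : Type u) (T : I → ModuleCat.{u} R),
      Function.Injective (BalancedTensor.piRightHom R M fun j => T j)) :
    IsMittagLeffler M := by
  intro P hP f
  let J := {N : Submodule Rᵐᵒᵖ (P × (M →₀ Rᵐᵒᵖ)) // N.FG ∧ N ≤ LinearMap.ker (freeCover f)}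
  choose Q hQ α h hf using fun N : J => exists_finitePresentation_factorization f N.2.1 N.2.2
  let g (N : J) : P →ₗ[Rᵐᵒᵖ] Q N := α N ∘ₗ N.1.mkQ ∘ₗ LinearMap.inl _ _ _
  by_contra! hbad
  have exists_witness (N : J) : ∃ (S : ModuleCat.{u} R) (x : BalancedTensor R P S),
      BalancedTensor.map f .id x = 0 ∧ BalancedTensor.map (g N) .id x ≠ 0 := by
    obtain ⟨S, hS⟩ := hbad (Q N) (hQ N) (g N)
    by_contra! hx
    refine hS (le_antisymm (hx S) fun x hx => ?_)
    rw [AddMonoidHom.mem_ker] at hx ⊢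
    rw [← hf N, BalancedTensor.map_id_comp_apply (h N) (g N), hx, map_zero]
  choose S x hfx hgx using exists_witness
  obtain ⟨y, hy⟩ := BalancedTensor.piRightHom_surjective_of_finite (fun N => S N) x
  have map_f : BalancedTensor.map f .id y = 0 := by
    refine (injective_iff_map_eq_zero _).1 (hM J S) _ (funext fun N => ?_)
    rw [BalancedTensor.piRightHom_map, hy, hfx, Pi.zero_apply]
  obtain ⟨N, hN, hle, hNy⟩ := exists_fg_map_mkQ_inl_eq_zero f map_f
  refine hgx ⟨N, hN, hle⟩ ?_
  rw [← hy, ← BalancedTensor.piRightHom_map (fun N => S N), BalancedTensor.map_id_comp_apply, hNy,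
    map_zero, map_zero, Pi.zero_apply]

theorem isMittagLeffler_iff_piRightHom_injective :
    IsMittagLeffler M ↔ ∀ (I : Type u) (T : I → ModuleCat.{u} R),
      Function.Injective (BalancedTensor.piRightHom R M fun j => T j) :=
  ⟨fun hM _ T => hM.piRightHom_injective T, isMittagLeffler_of_piRightHom_injective⟩

end MittagLeffler

section HomOrbits

variable {R : Type u} [Ring R] {ι κ : Type}

variable (R) in
/-- A family `w` of elements of a left module cuts out the orbit of `m` under homomorphisms if, for
every right module `N`, the finitely supported families in `N` that are orthogonal to `w` are
exactly the images of `m` under homomorphisms `M → N`. -/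
def CutsOutHomOrbit {M W : Type u} [AddCommGroup M] [Module Rᵐᵒᵖ M] [AddCommGroup W] [Module R W]
    (w : ι → W) (m : ι →₀ M) : Prop :=
  ∀ (N : ModuleCat.{u} Rᵐᵒᵖ) (n : ι →₀ N), BalancedTensor.sumTmul R w n = 0 ↔
    ∃ φ : M →ₗ[Rᵐᵒᵖ] N, Finsupp.mapRange.linearMap φ m = n

variable {M M' W : Type u} [AddCommGroup M] [Module Rᵐᵒᵖ M] [AddCommGroup M'] [Module Rᵐᵒᵖ M']
  [AddCommGroup W] [Module R W]

theorem finsuppScalarRight_sumTmul_coord [Fintype κ] (v : ι →₀ (κ → Rᵐᵒᵖ)) (z : κ →₀ M) :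
    BalancedTensor.finsuppScalarRight
        (BalancedTensor.sumTmul R (fun b => v.mapRange (fun a => unop (a b)) rfl) z) =
      Finsupp.mapRange.linearMap (Fintype.linearCombination Rᵐᵒᵖ z) v := by
  ext i
  induction z using Finsupp.induction_linear with
  | zero => simp [Fintype.linearCombination_apply]
  | add z z' hz hz' =>
    simp only [map_add, Finsupp.add_apply, hz, hz', Finsupp.mapRange.linearMap_apply,
      Finsupp.mapRange_apply, Fintype.linearCombination_apply, smul_add, Finset.sum_add_distrib]
  | single b x =>
    classical
    rw [BalancedTensor.sumTmul_single, BalancedTensor.finsuppScalarRight_tmul]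
    simp [Fintype.linearCombination_apply, Finsupp.single_apply]

theorem exists_cutsOutHomOrbit_of_free [Finite κ] (v : ι →₀ (κ → Rᵐᵒᵖ)) :
    ∃ (W : ModuleCat.{u} R) (w : ι → W), CutsOutHomOrbit R w v := by
  classical
  cases nonempty_fintype κ
  let c (b : κ) : ι →₀ R := v.mapRange (fun a => unop (a b)) rfl
  let U := Submodule.span R (Set.range c)
  refine ⟨ModuleCat.of R ((ι →₀ R) ⧸ U), fun i => U.mkQ (Finsupp.single i 1), fun N n => ?_⟩
  refine (BalancedTensor.sumTmul_mkQ_single_eq_zero_iff c n).trans ?_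
  simp only [c, finsuppScalarRight_sumTmul_coord]
  refine ⟨fun ⟨z, hz⟩ => ⟨_, hz⟩, ?_⟩
  rintro ⟨φ, rfl⟩
  refine ⟨Finsupp.equivFunOnFinite.symm fun b => φ (Pi.single b 1), ?_⟩
  congr 2
  refine LinearMap.pi_ext' fun b => LinearMap.ext_ring ?_
  simp [Fintype.linearCombination_apply_single]

theorem CutsOutHomOrbit.of_surjective {p : M →ₗ[Rᵐᵒᵖ] M'} (hp : Function.Surjective p)
    {r : κ →₀ M} (hr : Submodule.span Rᵐᵒᵖ (Set.range r) = LinearMap.ker p) {m : ι →₀ M}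
    {w : ι ⊕ κ → W} (hw : CutsOutHomOrbit R w (m.sumElim r)) :
    CutsOutHomOrbit R (w ∘ Sum.inl) (Finsupp.mapRange.linearMap p m) := by
  intro N n
  have mapRange_sumElim (ζ : M →ₗ[Rᵐᵒᵖ] N) :
      Finsupp.mapRange.linearMap ζ (m.sumElim r) = n.mapDomain Sum.inl ↔
        Finsupp.mapRange.linearMap ζ m = n ∧ LinearMap.ker p ≤ LinearMap.ker ζ := by
    rw [← hr, Submodule.span_le, Set.range_subset_iff]
    simp [Finsupp.ext_iff, Finsupp.mapDomain_apply Sum.inl_injective,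
      Finsupp.mapDomain_of_notMem_range]
  rw [← BalancedTensor.sumTmul_mapDomain, hw]
  simp only [mapRange_sumElim]
  constructor
  · rintro ⟨ζ, rfl, hζ⟩
    let φ := (LinearMap.ker p).liftQ ζ hζ ∘ₗ (p.quotKerEquivOfSurjective hp).symm.toLinearMap
    have symm_apply (x : M) :
        (p.quotKerEquivOfSurjective hp).symm (p x) = Submodule.Quotient.mk x :=
      (LinearEquiv.symm_apply_eq _).2 rfl
    have φ_comp : φ ∘ₗ p = ζ := by
      ext x
      simp [φ, symm_apply]
    exact ⟨φ, by rw [← mapRange_comp_apply, φ_comp]⟩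
  · rintro ⟨φ, rfl⟩
    exact ⟨φ ∘ₗ p, mapRange_comp_apply φ p m, LinearMap.ker_le_ker_comp p φ⟩

theorem CutsOutHomOrbit.of_retract {f : M →ₗ[Rᵐᵒᵖ] M'} {g : M' →ₗ[Rᵐᵒᵖ] M} {m : ι →₀ M}
    (hgf : Finsupp.mapRange.linearMap (g ∘ₗ f) m = m) {w : ι → W}
    (hw : CutsOutHomOrbit R w (Finsupp.mapRange.linearMap f m)) : CutsOutHomOrbit R w m := by
  refine fun N n => (hw N n).trans ⟨fun ⟨ψ, hψ⟩ => ⟨ψ ∘ₗ f, ?_⟩, fun ⟨φ, hφ⟩ => ⟨φ ∘ₗ g, ?_⟩⟩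
  · rw [mapRange_comp_apply, hψ]
  · rw [mapRange_comp_apply, ← mapRange_comp_apply g f, hgf, hφ]

theorem exists_cutsOutHomOrbit_of_finitePresentation [Module.FinitePresentation Rᵐᵒᵖ M]
    (m : ι →₀ M) : ∃ (W : ModuleCat.{u} R) (w : ι → W), CutsOutHomOrbit R w m := by
  obtain ⟨n, p, hp⟩ := Module.Finite.exists_fin' Rᵐᵒᵖ M
  obtain ⟨k, r, hr⟩ := Submodule.fg_iff_exists_fin_generating_family.1
    (Module.FinitePresentation.fg_ker p hp)
  obtain ⟨v, rfl⟩ := Finsupp.mapRange_surjective p (map_zero p) hp m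
  obtain ⟨W, w, hw⟩ :=
    exists_cutsOutHomOrbit_of_free (v.sumElim (Finsupp.equivFunOnFinite.symm r))
  exact ⟨W, _, hw.of_surjective hp hr⟩

end HomOrbits

section StrictMittagLeffler

variable {R : Type u} [Ring R] {M : ModuleCat.{u} Rᵐᵒᵖ} {ι : Type}

theorem IsStrictMittagLeffler.exists_cutsOutHomOrbit (hM : IsStrictMittagLeffler M) (m : ι →₀ M) :
    ∃ (W : ModuleCat.{u} R) (w : ι → W), CutsOutHomOrbit R w m := by
  obtain ⟨P, hP, f, g, hgf⟩ := hM (Submodule.span _ (Set.range m))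
    (Submodule.fg_span m.finite_range)
  obtain ⟨W, w, hw⟩ :=
    exists_cutsOutHomOrbit_of_finitePresentation (R := R) (Finsupp.mapRange.linearMap f m)
  refine ⟨W, w, hw.of_retract (g := g) (Finsupp.ext fun i => ?_)⟩
  exact DFunLike.congr_fun hgf ⟨m i, Submodule.subset_span (Set.mem_range_self i)⟩

variable (ι) in
theorem isStrictMittagLeffler_of_cutsOutHomOrbit [Infinite ι]
    (hM : ∀ m : ι →₀ M, ∃ (W : ModuleCat.{u} R) (w : ι → W), CutsOutHomOrbit R w m) :
    IsStrictMittagLeffler M := by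
  intro L hL
  obtain ⟨m, rfl⟩ := exists_span_range_eq (ι := ι) hL
  obtain ⟨W, w, hw⟩ := hM m
  obtain ⟨n, f, b, hb⟩ := exists_mapRange_eq (A := Rᵐᵒᵖ) m
  have map_f : BalancedTensor.map f .id (BalancedTensor.sumTmul R w b) = 0 := by
    rw [BalancedTensor.map_sumTmul, hb]
    exact (hw M m).2 ⟨.id, by simp⟩
  obtain ⟨Q, hQ, g, h, rfl, hgb⟩ := exists_finitePresentation_map_eq_zero f map_f
  rw [BalancedTensor.map_sumTmul] at hgb
  obtain ⟨φ, hφ⟩ := (hw Q _).1 hgb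
  have retract : Finsupp.mapRange.linearMap (h ∘ₗ φ) m = m := by
    rw [mapRange_comp_apply, hφ, ← mapRange_comp_apply, hb]
  refine ⟨Q, hQ, φ, h, LinearMap.ext fun ⟨x, hx⟩ => ?_⟩
  refine LinearMap.eqOn_span (f := h ∘ₗ φ) (g := .id) ?_ hx
  rintro _ ⟨i, rfl⟩
  exact DFunLike.congr_fun retract i

variable (ι) in
theorem isStrictMittagLeffler_iff_exists_cutsOutHomOrbit [Infinite ι] :
    IsStrictMittagLeffler M ↔
      ∀ m : ι →₀ M, ∃ (W : ModuleCat.{u} R) (w : ι → W), CutsOutHomOrbit R w m :=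
  ⟨fun hM => hM.exists_cutsOutHomOrbit, isStrictMittagLeffler_of_cutsOutHomOrbit ι⟩

end StrictMittagLeffler

section PointwiseFunctors

theorem nonempty_isLimit_fan_iff_bijective {J : Type*} [Small.{u} J] {A : J → AddCommGrpCat.{u}}
    (c : Fan A) :
    Nonempty (IsLimit c) ↔ Function.Bijective fun (y : c.pt) (j : J) => c.proj j y := by
  have forget_iff : Nonempty (IsLimit c) ↔ Nonempty (IsLimit ((forget AddCommGrpCat).mapCone c)) :=
    ⟨fun ⟨hc⟩ => ⟨isLimitOfPreserves _ hc⟩, fun ⟨hc⟩ => ⟨isLimitOfReflects _ hc⟩⟩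
  rw [forget_iff, Types.isLimit_iff, Function.bijective_iff_existsUnique]
  constructor
  · intro h x
    obtain ⟨y, hy, hy'⟩ := h (fun j => x j.as) fun {j j'} g => by
      obtain rfl : j = j' := Discrete.ext (Discrete.eq_of_hom g)
      obtain rfl : g = 𝟙 j := Subsingleton.elim _ _
      simp
    exact ⟨y, funext fun j => hy ⟨j⟩, fun z hz => hy' z fun j => congrFun hz j.as⟩
  · intro h s _
    obtain ⟨y, hy, hy'⟩ := h fun j => s ⟨j⟩
    exact ⟨y, fun j => congrFun hy j.as, fun z hz => hy' z (funext fun j => hz ⟨j⟩)⟩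

variable {R : Type u} [Ring R] {F G : FunctorOfModules R}

/-- The natural map `𝔽(∏ⱼ Tⱼ) → ∏ⱼ 𝔽(Tⱼ)`. -/
def productComparison (F : FunctorOfModules R) {I : Type u} (T : I → ModuleCat.{u} R) :
    F.obj (ModuleCat.of R (∀ j, T j)) →+ ∀ j, F.obj (T j) :=
  AddMonoidHom.pi fun j => (F.map (ModuleCat.ofHom (LinearMap.proj j))).hom

theorem productComparison_app (f : F ⟶ G) {I : Type u} (T : I → ModuleCat.{u} R)
    (y : F.obj (ModuleCat.of R (∀ j, T j))) (j : I) :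
    productComparison G T (f.app _ y) j = f.app (T j) (productComparison F T y j) :=
  (NatTrans.naturality_apply f _ y).symm

theorem preservesDirectProducts_iff_bijective :
    PreservesDirectProducts F ↔
      ∀ (I : Type u) (T : I → ModuleCat.{u} R), Function.Bijective (productComparison F T) := by
  have isLimit_iff {I : Type u} (T : I → ModuleCat.{u} R) :
      Nonempty (IsLimit (F.mapCone (ModuleCat.productCone T))) ↔
        Function.Bijective (productComparison F T) :=
    (isLimitMapConeFanMkEquiv F T _).nonempty_congr.trans (nonempty_isLimit_fan_iff_bijective _)
  refine ⟨fun h I T => ?_, fun h I => ⟨fun {K} => ?_⟩⟩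
  · have := h I
    exact (isLimit_iff T).1 ⟨isLimitOfPreserves F (ModuleCat.productConeIsLimit T)⟩
  · have : PreservesLimit (Discrete.functor (K.obj ∘ Discrete.mk)) F :=
      preservesLimit_of_preserves_limit_cone (ModuleCat.productConeIsLimit _)
        ((isLimit_iff _).2 (h I _)).some
    exact preservesLimit_of_iso_diagram F Discrete.natIsoFunctor.symm

theorem app_injective_of_mono (f : F ⟶ G) [Mono f] (S : ModuleCat.{u} R) :
    Function.Injective (f.app S) :=
  (AddCommGrpCat.mono_iff_injective _).1 inferInstance

theorem exact_iff_forall_app {X : ShortComplex (FunctorOfModules R)} :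
    X.Exact ↔ ∀ (S : ModuleCat.{u} R) (x : X.X₂.obj S), X.g.app S x = 0 →
      ∃ y, X.f.app S y = x := by
  rw [X.exact_iff_isZero_homology, Functor.isZero_iff]
  refine forall_congr' fun S => ?_
  have : (X.map ((evaluation _ _).obj S)).Exact ↔ IsZero (X.homology.obj S) :=
    (ShortComplex.exact_iff_isZero_homology _).trans
      (X.mapHomologyIso ((evaluation _ _).obj S)).isZero_iff
  exact this.symm.trans (ShortComplex.ab_exact_iff _)

theorem preservesDirectProducts_kernel_iff (f : F ⟶ G) (hF : PreservesDirectProducts F) :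
    PreservesDirectProducts (kernel f) ↔ ∀ (I : Type u) (T : I → ModuleCat.{u} R)
      (y : F.obj (ModuleCat.of R (∀ j, T j))),
      productComparison G T (f.app _ y) = 0 → f.app _ y = 0 := by
  rw [preservesDirectProducts_iff_bijective] at hF ⊢
  have app_ι (S : ModuleCat.{u} R) (x) : f.app S ((kernel.ι f).app S x) = 0 :=
    congrArg (fun η : kernel f ⟶ G => η.app S x) (kernel.condition f)
  have exists_ι := exact_iff_forall_app.1 (ShortComplex.exact_kernel f)
  have ι_injective := app_injective_of_mono (kernel.ι f)
  constructor
  · intro h I T y hy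
    choose x hx using fun j => exists_ι (T j) (productComparison F T y j)
      ((productComparison_app f T y j).symm.trans (congrFun hy j))
    obtain ⟨z, rfl⟩ := (h I T).2 x
    have hz : (kernel.ι f).app _ z = y := (hF I T).1 (funext fun j =>
      (productComparison_app (kernel.ι f) T z j).trans (hx j))
    rw [← hz, app_ι]
  · refine fun h I T => ⟨fun z z' hz => ι_injective _ ((hF I T).1 ?_), fun x => ?_⟩
    · funext j
      rw [productComparison_app, productComparison_app, hz]
    · obtain ⟨y, hy⟩ := (hF I T).2 fun j => (kernel.ι f).app _ (x j)
      obtain ⟨z, rfl⟩ := exists_ι _ y (h I T y (funext fun j => by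
        rw [productComparison_app, hy, app_ι, Pi.zero_apply]))
      refine ⟨z, funext fun j => ι_injective _ ?_⟩
      rw [← productComparison_app, hy]

theorem exists_mono_cokernel_iff (f : F ⟶ G) (H : FunctorOfModules R) :
    (∃ i : cokernel f ⟶ H, Mono i) ↔
      ∃ t : G ⟶ H, ∀ S (x : G.obj S), t.app S x = 0 ↔ ∃ y, f.app S y = x := by
  constructor
  · rintro ⟨i, _⟩
    refine ⟨cokernel.π f ≫ i, fun S x => ⟨fun hx => ?_, ?_⟩⟩
    · exact exact_iff_forall_app.1 (ShortComplex.exact_cokernel f) S x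
        (app_injective_of_mono i S (hx.trans (map_zero (i.app S).hom).symm))
    · rintro ⟨y, rfl⟩
      exact congrArg (fun η : F ⟶ H => η.app S y) ((cokernel.condition_assoc f i).trans zero_comp)
  · rintro ⟨t, ht⟩
    have hft : f ≫ t = 0 := by
      ext S y
      exact (ht S _).2 ⟨y, rfl⟩
    have hexact : (ShortComplex.mk f t hft).Exact :=
      exact_iff_forall_app.2 fun S x => (ht S x).1
    exact ⟨cokernel.desc f t hft, (ShortComplex.exact_iff_mono_cokernel_desc _).1 hexact⟩

end PointwiseFunctors

section TensorFunctors

variable {R : Type u} [Ring R] (M : ModuleCat.{u} Rᵐᵒᵖ) (S : ModuleCat.{u} R)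

/-- The values of `tensorBifunctor` are lifted to the next universe; this identifies them with the
tensor products themselves. -/
def tensorObjEquiv : ((tensorBifunctor R).obj M).obj S ≃+ BalancedTensor R M S :=
  AddEquiv.ulift

end TensorFunctors

section Power

variable {R : Type u} [Ring R] {M : ModuleCat.{u} Rᵐᵒᵖ} {S S' : ModuleCat.{u} R} {ι : Type}

variable (R ι) in
/-- The power `∏_ι 𝓡`. -/
abbrev power : FunctorOfModules R :=
  ∏ᶜ fun _ : ι => quasiCoherent (ModuleCat.of Rᵐᵒᵖ R)

/-- The projection of `∏_ι 𝓡` to its `i`-th factor. -/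
abbrev powerProj (i : ι) : power R ι ⟶ quasiCoherent (ModuleCat.of Rᵐᵒᵖ R) :=
  Pi.π _ i

variable (S) in
/-- The isomorphism `𝓡(S) = R ⊗_R S ≃ S`. -/
def unitObjEquiv : (quasiCoherent (ModuleCat.of Rᵐᵒᵖ R)).obj S ≃+ S :=
  (tensorObjEquiv _ S).trans BalancedTensor.lid

variable (S) in
/-- The family in `S` that corresponds to an element of `(∏_ι 𝓡)(S)` under `𝓡(S) ≃ S`. -/
def powerCoord : (power R ι).obj S →+ (ι → S) :=
  AddMonoidHom.pi fun i => (unitObjEquiv S).toAddMonoidHom.comp ((powerProj i).app S).hom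

theorem powerCoord_bijective : Function.Bijective (powerCoord (ι := ι) S) :=
  (Equiv.piCongrRight fun _ : ι => (unitObjEquiv S).toEquiv).bijective.comp
    ((nonempty_isLimit_fan_iff_bijective _).1
      ⟨isLimitFanMkObjOfIsLimit ((evaluation _ _).obj S) _ _ (productIsProduct _)⟩)

theorem powerCoord_map (g : S ⟶ S') (y : (power R ι).obj S) (i : ι) :
    powerCoord S' ((power R ι).map g y) i = g (powerCoord S y i) :=
  (congrArg (unitObjEquiv S') (NatTrans.naturality_apply (powerProj i) g y)).trans
    (BalancedTensor.lid_map g.hom _)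

variable (R ι) in
theorem preservesDirectProducts_power : PreservesDirectProducts (power R ι) := by
  refine preservesDirectProducts_iff_bijective.2 fun I T => ?_
  have coords_bijective : Function.Bijective fun (x : ∀ j, (power R ι).obj (T j)) j =>
      powerCoord (T j) (x j) :=
    (Equiv.piCongrRight fun j => Equiv.ofBijective _ (powerCoord_bijective (S := T j))).bijective
  have coords_comparison : (fun x j => powerCoord (T j) (x j)) ∘ productComparison (power R ι) T =
      Function.swap ∘ powerCoord (ModuleCat.of R (∀ j, T j)) := by
    funext y j i
    exact powerCoord_map _ y i
  rw [← Function.Bijective.of_comp_iff' coords_bijective, coords_comparison]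
  exact (Equiv.piComm _).bijective.comp powerCoord_bijective

theorem exists_power_hom_app_eq_sumTmul (m : ι →₀ M) :
    ∃ f : power R ι ⟶ quasiCoherent M, ∀ (S : ModuleCat.{u} R) (y : (power R ι).obj S),
      tensorObjEquiv M S (f.app S y) = BalancedTensor.sumTmul R (powerCoord S y) m := by
  induction m using Finsupp.induction_linear with
  | zero => exact ⟨0, fun S y => (map_zero _).symm⟩
  | add m m' hm hm' =>
    obtain ⟨f, hf⟩ := hm
    obtain ⟨f', hf'⟩ := hm'
    refine ⟨f + f', fun S y => ?_⟩
    rw [map_add, ← hf, ← hf']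
    rfl
  | single i x =>
    refine ⟨powerProj i ≫ (tensorBifunctor R).map
      (ModuleCat.ofHom (BalancedTensor.toSpanSingletonRight x)), fun S y => ?_⟩
    rw [BalancedTensor.sumTmul_single]
    exact (BalancedTensor.map_left_eq_tmul_lid _ _).trans
      (congrArg (BalancedTensor.tmul R · _) (BalancedTensor.toSpanSingletonRight_one x))

variable (ι) in
theorem isMittagLeffler_iff_preservesDirectProducts_kernel [Infinite ι] :
    IsMittagLeffler M ↔
      ∀ f : power R ι ⟶ quasiCoherent M, PreservesDirectProducts (kernel f) := by
  simp only [isMittagLeffler_iff_piRightHom_injective,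
    preservesDirectProducts_kernel_iff _ (preservesDirectProducts_power R ι)]
  have comparison_eq_zero_iff {I : Type u} (T : I → ModuleCat.{u} R)
      (z : (quasiCoherent M).obj (ModuleCat.of R (∀ j, T j))) :
      productComparison (quasiCoherent M) T z = 0 ↔
        BalancedTensor.piRightHom R M (fun j => T j) (tensorObjEquiv M _ z) = 0 := by
    simp only [funext_iff]
    exact forall_congr' fun j => (EmbeddingLike.map_eq_zero_iff (f := tensorObjEquiv M (T j))).symm
  constructor
  · intro h f I T y hy
    rw [comparison_eq_zero_iff, map_eq_zero_iff _ (h I T)] at hy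
    exact (EmbeddingLike.map_eq_zero_iff (f := tensorObjEquiv M _)).1 hy
  · intro h I T
    refine (injective_iff_map_eq_zero _).2 fun x hx => ?_
    obtain ⟨s, m, rfl⟩ := BalancedTensor.exists_sumTmul_eq (ι := ι) x
    obtain ⟨f, hf⟩ := exists_power_hom_app_eq_sumTmul m
    obtain ⟨y, rfl⟩ := (powerCoord_bijective (S := ModuleCat.of R (∀ j, T j))).2 s
    rw [← hf, ← comparison_eq_zero_iff] at hx
    rw [← hf, h f I T y hx, map_zero]

end Power

section Copower

variable {R : Type u} [Ring R] {N N' : ModuleCat.{u} Rᵐᵒᵖ} {W : ModuleCat.{u} R} {ι : Type}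

variable (R ι) in
/-- The copower `⨁_ι 𝓡` of right `𝓡`-modules. -/
abbrev copower : FunctorOfModules Rᵐᵒᵖ :=
  ∐ fun _ : ι => quasiCoherentRight (ModuleCat.of R R)

/-- The inclusion of the `i`-th summand of `⨁_ι 𝓡`. -/
abbrev copowerIncl (i : ι) : quasiCoherentRight (ModuleCat.of R R) ⟶ copower R ι :=
  Sigma.ι (fun _ : ι => quasiCoherentRight (ModuleCat.of R R)) i

variable (N) in
/-- The isomorphism `𝓡(N) = N ⊗_R R ≃ N`. -/
def unitRightObjEquiv : (quasiCoherentRight (ModuleCat.of R R)).obj N ≃+ N :=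
  (tensorObjEquiv N (ModuleCat.of R R)).trans BalancedTensor.rid

variable (N) in
/-- The element of `(⨁_ι 𝓡)(N)` that corresponds to a finitely supported family in `N` under
`N ≃ 𝓡(N)`. -/
def copowerMk : (ι →₀ N) →+ (copower R ι).obj N :=
  Finsupp.liftAddHom fun i =>
    ((copowerIncl i).app N).hom.comp (unitRightObjEquiv N).symm.toAddMonoidHom

theorem copowerMk_single (i : ι) (x : N) :
    copowerMk N (Finsupp.single i x) =
      (copowerIncl i).app N ((unitRightObjEquiv N).symm x) :=
  Finsupp.liftAddHom_apply_single _ _ _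

theorem map_copowerMk (g : N →ₗ[Rᵐᵒᵖ] N') (n : ι →₀ N) :
    (copower R ι).map (ModuleCat.ofHom g) (copowerMk N n) =
      copowerMk N' (Finsupp.mapRange.linearMap g n) := by
  induction n using Finsupp.induction_linear with
  | zero => simp only [map_zero]
  | add n n' hn hn' => simp only [map_add, hn, hn']
  | single i x =>
    rw [Finsupp.mapRange.linearMap_apply, Finsupp.mapRange_single, copowerMk_single,
      copowerMk_single]
    exact (NatTrans.naturality_apply (copowerIncl i) (ModuleCat.ofHom g) _).symm

variable (N) in
theorem copowerMk_surjective : Function.Surjective (copowerMk (ι := ι) N) := by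
  let q : (copower R ι).obj N ⟶ AddCommGrpCat.of ((copower R ι).obj N ⧸ (copowerMk N).range) :=
    AddCommGrpCat.ofHom (QuotientAddGroup.mk' _)
  have copower_isColimit :=
    isColimitCofanMkObjOfIsColimit ((evaluation _ AddCommGrpCat.{u + 1}).obj N) _ _
      (coproductIsCoproduct fun _ : ι => quasiCoherentRight (ModuleCat.of R R))
  have hq : q = 0 := by
    refine Cofan.IsColimit.hom_ext copower_isColimit _ _ fun i => ?_
    ext z
    refine (QuotientAddGroup.eq_zero_iff _).2 ⟨Finsupp.single i (unitRightObjEquiv N z), ?_⟩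
    rw [copowerMk_single, AddEquiv.symm_apply_apply]
    rfl
  exact fun x => (QuotientAddGroup.eq_zero_iff x).1 (congrArg (fun g => g.hom x) hq)

theorem app_copowerMk (t : copower R ι ⟶ quasiCoherentRight W) (w : ι → W)
    (hw : ∀ i, tensorObjEquiv (ModuleCat.of Rᵐᵒᵖ R) W
      (t.app (ModuleCat.of Rᵐᵒᵖ R) (copowerMk (ModuleCat.of Rᵐᵒᵖ R) (Finsupp.single i (1 : R)))) =
        BalancedTensor.tmul R (1 : R) (w i)) (n : ι →₀ N) :
    tensorObjEquiv N W (t.app N (copowerMk N n)) = BalancedTensor.sumTmul R w n := by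
  induction n using Finsupp.induction_linear with
  | zero => simp only [map_zero]
  | add n n' hn hn' => simp only [map_add, hn, hn']
  | single i x =>
    have single_eq : Finsupp.single i x = Finsupp.mapRange.linearMap
        (BalancedTensor.toSpanSingletonRight x) (Finsupp.single i (1 : R)) := by
      rw [Finsupp.mapRange.linearMap_apply, Finsupp.mapRange_single,
        BalancedTensor.toSpanSingletonRight_one]
    rw [single_eq, ← map_copowerMk (N := ModuleCat.of Rᵐᵒᵖ R), NatTrans.naturality_apply]
    refine (congrArg (BalancedTensor.map _ .id) (hw i)).trans ?_
    rw [BalancedTensor.map_tmul, ← single_eq, BalancedTensor.sumTmul_single]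
    exact congrArg (BalancedTensor.tmul R · (w i)) (BalancedTensor.toSpanSingletonRight_one x)

theorem exists_copower_hom_app_eq_sumTmul (w : ι → W) :
    ∃ t : copower R ι ⟶ quasiCoherentRight W, ∀ (N : ModuleCat.{u} Rᵐᵒᵖ) (n : ι →₀ N),
      tensorObjEquiv N W (t.app N (copowerMk N n)) = BalancedTensor.sumTmul R w n := by
  let t : copower R ι ⟶ quasiCoherentRight W := Limits.Sigma.desc fun i =>
    (tensorBifunctor R).flip.map (ModuleCat.ofHom (LinearMap.toSpanSingleton R W (w i)))
  refine ⟨t, fun _ => app_copowerMk t w fun i => ?_⟩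
  have incl_comp : copowerIncl i ≫ t = (tensorBifunctor R).flip.map
      (ModuleCat.ofHom (LinearMap.toSpanSingleton R W (w i))) := Limits.Sigma.ι_desc _ i
  rw [copowerMk_single, ← NatTrans.comp_app_apply, incl_comp]
  exact congrArg (BalancedTensor.tmul R (1 : R)) (one_smul R (w i))

theorem exists_family_app_eq_sumTmul (t : copower R ι ⟶ quasiCoherentRight W) :
    ∃ w : ι → W, ∀ (N : ModuleCat.{u} Rᵐᵒᵖ) (n : ι →₀ N),
      tensorObjEquiv N W (t.app N (copowerMk N n)) = BalancedTensor.sumTmul R w n :=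
  ⟨fun i => unitObjEquiv W (t.app _ (copowerMk _ (Finsupp.single i 1))), fun _ =>
    app_copowerMk t _ fun _ => (BalancedTensor.lid.symm_apply_apply _).symm⟩

variable (N) in
theorem copowerMk_injective : Function.Injective (copowerMk (ι := ι) N) := by
  obtain ⟨t, ht⟩ := exists_copower_hom_app_eq_sumTmul (R := R)
    (W := ModuleCat.of R (ι →₀ R)) fun i => Finsupp.single i 1
  intro n n' h
  refine (BalancedTensor.finsuppScalarRight (R := R)).symm.injective ?_
  rw [BalancedTensor.finsuppScalarRight_symm_apply, BalancedTensor.finsuppScalarRight_symm_apply]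
  exact (ht N n).symm.trans ((congrArg (tensorObjEquiv N _ <| t.app N ·) h).trans (ht N n'))

end Copower

section Dual

variable {R : Type u} [Ring R] {M N : ModuleCat.{u} Rᵐᵒᵖ} {ι : Type}

instance tensorBifunctor_full : (tensorBifunctor R).Full where
  map_surjective {M N} η := by
    let e (S : ModuleCat.{u} R) : BalancedTensor R M S →+ BalancedTensor R N S :=
      ((tensorObjEquiv N S).toAddMonoidHom.comp (η.app S).hom).comp
        (tensorObjEquiv M S).symm.toAddMonoidHom
    have e_map {S : ModuleCat.{u} R} (g : R →ₗ[R] S) (x : BalancedTensor R M R) :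
        e S (BalancedTensor.map .id g x) =
          BalancedTensor.map .id g (e (ModuleCat.of R R) x) :=
      congrArg (tensorObjEquiv N S)
        (NatTrans.naturality_apply η (ModuleCat.ofHom g) ((tensorObjEquiv M _).symm x))
    let φ : M →+ N := (BalancedTensor.rid.toAddMonoidHom.comp (e (ModuleCat.of R R))).comp
      BalancedTensor.rid.symm.toAddMonoidHom
    have e_tmul (S : ModuleCat.{u} R) (m : M) (s : S) :
        e S (BalancedTensor.tmul R m s) = BalancedTensor.tmul R (φ m) s := by
      have := (e_map (LinearMap.toSpanSingleton R S s) (BalancedTensor.tmul R m 1)).trans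
        (BalancedTensor.map_right_eq_tmul_rid _ _)
      rwa [BalancedTensor.map_tmul, LinearMap.toSpanSingleton_apply_one] at this
    have φ_smul (r : Rᵐᵒᵖ) (m : M) : φ (r • m) = r • φ m := by
      have : BalancedTensor.tmul R (r • m) 1 = BalancedTensor.tmul R m (unop r) :=
        (BalancedTensor.smul_tmul (unop r) m 1).trans (congrArg _ (mul_one (unop r)))
      exact (congrArg (fun x => BalancedTensor.rid (e (ModuleCat.of R R) x)) this).trans
        (congrArg BalancedTensor.rid (e_tmul (ModuleCat.of R R) m (unop r)))
    let φ' : M →ₗ[Rᵐᵒᵖ] N := { φ with map_smul' := φ_smul }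
    have e_eq (S : ModuleCat.{u} R) : e S = BalancedTensor.map φ' .id :=
      BalancedTensor.hom_ext (e_tmul S)
    refine ⟨ModuleCat.ofHom φ', ?_⟩
    ext S x
    exact (tensorObjEquiv N S).injective
      (DFunLike.congr_fun (e_eq S) (tensorObjEquiv M S x)).symm

/-- The element of `𝓜^*(N)` given by a homomorphism `M → N`. -/
def dualMk (φ : M →ₗ[Rᵐᵒᵖ] N) : (dual (quasiCoherent M)).obj N :=
  (tensorBifunctor R).map (ModuleCat.ofHom φ)

theorem dualMk_surjective :
    Function.Surjective (dualMk : (M →ₗ[Rᵐᵒᵖ] N) → (dual (quasiCoherent M)).obj N) := fun y => by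
  obtain ⟨φ, hφ⟩ := (tensorBifunctor R).map_surjective y
  exact ⟨φ.hom, hφ⟩

theorem map_dualMk_id (φ : M →ₗ[Rᵐᵒᵖ] N) :
    (dual (quasiCoherent M)).map (ModuleCat.ofHom φ) (dualMk .id) = dualMk φ :=
  ((tensorBifunctor R).map_comp (𝟙 M) (ModuleCat.ofHom φ)).symm.trans
    (congrArg _ (Category.id_comp _))

/-- The morphism `𝓜^* → 𝓡` that evaluates at an element of `M`. -/
def dualEval (x : M) : dual (quasiCoherent M) ⟶ quasiCoherentRight (ModuleCat.of R R) where
  app N := AddCommGrpCat.ofHom (AddMonoidHom.mk'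
    (fun η : quasiCoherent M ⟶ quasiCoherent N =>
      η.app (ModuleCat.of R R) ((unitRightObjEquiv M).symm x))
    fun _ _ => rfl)
  naturality _ _ _ := rfl

theorem exists_family_app_dualMk (f : dual (quasiCoherent M) ⟶ copower R ι) :
    ∃ m : ι →₀ M, ∀ (N : ModuleCat.{u} Rᵐᵒᵖ) (φ : M →ₗ[Rᵐᵒᵖ] N),
      f.app N (dualMk φ) = copowerMk N (Finsupp.mapRange.linearMap φ m) := by
  obtain ⟨m, hm⟩ := copowerMk_surjective M (f.app M (dualMk .id))
  refine ⟨m, fun N φ => ?_⟩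
  rw [← map_dualMk_id, NatTrans.naturality_apply, ← hm, map_copowerMk]

theorem exists_dual_hom_app_dualMk (m : ι →₀ M) :
    ∃ f : dual (quasiCoherent M) ⟶ copower R ι,
      ∀ (N : ModuleCat.{u} Rᵐᵒᵖ) (φ : M →ₗ[Rᵐᵒᵖ] N),
        f.app N (dualMk φ) = copowerMk N (Finsupp.mapRange.linearMap φ m) := by
  induction m using Finsupp.induction_linear with
  | zero =>
    refine ⟨0, fun N φ => ?_⟩
    rw [map_zero, map_zero]
    rfl
  | add m m' hm hm' =>
    obtain ⟨f, hf⟩ := hm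
    obtain ⟨f', hf'⟩ := hm'
    refine ⟨f + f', fun N φ => ?_⟩
    rw [map_add, map_add, ← hf, ← hf']
    rfl
  | single i x =>
    refine ⟨dualEval x ≫ copowerIncl i, fun N φ => ?_⟩
    rw [Finsupp.mapRange.linearMap_apply, Finsupp.mapRange_single, copowerMk_single]
    rfl

theorem exists_mono_cokernel_iff_exists_cutsOutHomOrbit
    {f : dual (quasiCoherent M) ⟶ copower R ι} {m : ι →₀ M}
    (hf : ∀ (N : ModuleCat.{u} Rᵐᵒᵖ) (φ : M →ₗ[Rᵐᵒᵖ] N),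
      f.app N (dualMk φ) = copowerMk N (Finsupp.mapRange.linearMap φ m)) :
    (∃ (W : ModuleCat.{u} R) (i : cokernel f ⟶ quasiCoherentRight W), Mono i) ↔
      ∃ (W : ModuleCat.{u} R) (w : ι → W), CutsOutHomOrbit R w m := by
  have exists_app_eq_iff (N : ModuleCat.{u} Rᵐᵒᵖ) (n : ι →₀ N) :
      (∃ y, f.app N y = copowerMk N n) ↔
        ∃ φ : M →ₗ[Rᵐᵒᵖ] N, Finsupp.mapRange.linearMap φ m = n := by
    rw [dualMk_surjective.exists]
    simp only [hf, (copowerMk_injective N).eq_iff]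
  have isExact_iff {W : ModuleCat.{u} R} (t : copower R ι ⟶ quasiCoherentRight W) (w : ι → W)
      (hw : ∀ (N : ModuleCat.{u} Rᵐᵒᵖ) (n : ι →₀ N),
        tensorObjEquiv N W (t.app N (copowerMk N n)) = BalancedTensor.sumTmul R w n) :
      (∀ N x, t.app N x = 0 ↔ ∃ y, f.app N y = x) ↔ CutsOutHomOrbit R w m := by
    refine forall_congr' fun N => (copowerMk_surjective N).forall.trans (forall_congr' fun n => ?_)
    rw [exists_app_eq_iff, ← hw, EmbeddingLike.map_eq_zero_iff (f := tensorObjEquiv N W)]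
  simp only [exists_mono_cokernel_iff]
  refine exists_congr fun W => ⟨fun ⟨t, ht⟩ => ?_, fun ⟨w, hw⟩ => ?_⟩
  · obtain ⟨w, hw⟩ := exists_family_app_eq_sumTmul t
    exact ⟨w, (isExact_iff t w hw).1 ht⟩
  · obtain ⟨t, ht⟩ := exists_copower_hom_app_eq_sumTmul w
    exact ⟨t, (isExact_iff t w ht).2 hw⟩

variable (ι) in
theorem isStrictMittagLeffler_iff_exists_mono_cokernel [Infinite ι] :
    IsStrictMittagLeffler M ↔ ∀ f : dual (quasiCoherent M) ⟶ copower R ι,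
      ∃ (W : ModuleCat.{u} R) (i : cokernel f ⟶ quasiCoherentRight W), Mono i := by
  rw [isStrictMittagLeffler_iff_exists_cutsOutHomOrbit ι]
  constructor
  · intro h f
    obtain ⟨m, hf⟩ := exists_family_app_dualMk f
    exact (exists_mono_cokernel_iff_exists_cutsOutHomOrbit hf).2 (h m)
  · intro h m
    obtain ⟨f, hf⟩ := exists_dual_hom_app_dualMk m
    exact (exists_mono_cokernel_iff_exists_cutsOutHomOrbit hf).1 (h f)

end Dual

end

end FunctorialModules

theorem mainTheorem5_general (ι : Type) [Infinite ι] (R : Type u) [Ring R]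
    (M : ModuleCat.{u} Rᵐᵒᵖ) :
    (FunctorialModules.IsMittagLeffler M ↔
      ∀ f : FunctorialModules.power R ι ⟶ FunctorialModules.quasiCoherent M,
        FunctorialModules.PreservesDirectProducts (kernel f)) ∧
    (FunctorialModules.IsStrictMittagLeffler M ↔
      ∀ f : FunctorialModules.dual (FunctorialModules.quasiCoherent M) ⟶
          FunctorialModules.copower R ι,
        ∃ (N : ModuleCat.{u} R) (i : cokernel f ⟶ FunctorialModules.quasiCoherentRight N),
          Mono i) :=
  ⟨FunctorialModules.isMittagLeffler_iff_preservesDirectProducts_kernel ι,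
    FunctorialModules.isStrictMittagLeffler_iff_exists_mono_cokernel ι⟩

theorem mainTheorem5 (R : Type u) [Ring R] (M : ModuleCat.{u} Rᵐᵒᵖ) :
    (FunctorialModules.IsMittagLeffler M ↔
      ∀ f : (∏ᶜ fun _ : ℕ => FunctorialModules.quasiCoherent (ModuleCat.of Rᵐᵒᵖ R)) ⟶
          FunctorialModules.quasiCoherent M,
        FunctorialModules.PreservesDirectProducts (kernel f)) ∧
    (FunctorialModules.IsStrictMittagLeffler M ↔
      ∀ f : FunctorialModules.dual (FunctorialModules.quasiCoherent M) ⟶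
          ∐ fun _ : ℕ => FunctorialModules.quasiCoherentRight (ModuleCat.of R R),
        ∃ (N : ModuleCat.{u} R) (i : cokernel f ⟶ FunctorialModules.quasiCoherentRight N),
          Mono i) :=
  mainTheorem5_general ℕ R M
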